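/- Let $\mathbb K$ be a field of characteristic $0$, let $k\ge 0$, let $F_0(u)\in\mathbb K[u]$ and let $Q(y_0,y_1,\ldots,y_k,t,v)$ be a polynomial in $k+3$ indeterminates with coefficients in $\mathbb K$. For a series $F(u)\equiv F(t,u)\in\mathbb K[u][[t]]$, let $\Delta F(u)=\dfrac{F(u)-F(0)}{u}$ be its divided difference with respect to $u$, where $F(0)=F(t,0)$, and let $\Delta^{(i)}$ denote $\Delta$ applied $i$ times. Then the equation $$F(u)=F_0(u)+t\,Q\bigl(F(u),\Delta F(u),\Delta^{(2)}F(u),\ldots,\Delta^{(k)}F(u),t,u\bigr)$$ has a unique solution $F(t,u)$ in $\mathbb K[u][[t]]$. This series $F(t,u)$ is algebraic over $\mathbb K(t,u)$. Moreover, for every $i\ge 1$, the series $F_i(t)\in\mathbb K[[t]]$, defined as the coefficient of $u^{i-1}$ in $F(t,u)$, is algebraic over $\mathbb K(t)$ (and hence over $\mathbb K(t,u)$). -/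

import Mathlib

/-!
Differentiate the equation along a derivation `δ` that kills `t` and `u`. Since
`u Δ^(i+1) F = Δ^(i) F - F_{i+1}`, this gives
`(u^k - t H_0) δF = -t ∑_{j=1}^k u^(j-1) H_j δF_j`, where `H_j = ∑_{i=j}^k u^(k-i) ∂Q/∂y_i`.
Suppose that `∂Q/∂y_k` is nonzero at the origin. Then every `H_j` is a unit of `K[[t]][[u]]`, so by
Weierstrass preparation and Eisenstein's criterion `K[[t]][[u]]/(u^k - t H_0)` is a totally
ramified extension of degree `k` of `K[[t]]`, with uniformizer `u`. In this quotient the left-hand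
side vanishes, while the elements `u^(j-1) H_j` have the distinct valuations `0, …, k - 1` and so
are linearly independent over `K[[t]]`. Hence all `δF_j` with `j ≤ k` vanish, which for a suitable
`δ` is impossible if one of these `F_j` is transcendental. Once `F_1, …, F_k` are algebraic, the
same identity in `K[u][[t]]`, where the kernel `u^k - t H_0` is nonzero, shows that `F` is
algebraic.

The general case follows by specialization. A series `F` is algebraic over `R[X]` exactly when the
products `X^i F^j` are linearly dependent over `R`, that is, when for some finite family of them all
maximal minors of the matrix of coefficients are zero, and the vanishing of minors survives any ring
homomorphism. It therefore suffices to lift `F₀` and `Q` to a domain of characteristic zero and to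
add `ε y_k` to the lift of `Q`, with a new parameter `ε`.
-/

namespace Catalytic

variable {K : Type*} [Field K]

/-- The variable `t` of `K[u][[t]]`. -/
noncomputable def tVar (K : Type*) [Field K] : PowerSeries (Polynomial K) :=
  PowerSeries.X

/-- The catalytic variable `u` of `K[u][[t]]`. -/
noncomputable def uVar (K : Type*) [Field K] : PowerSeries (Polynomial K) :=
  PowerSeries.C Polynomial.X

/-- The series `[u^i] F(t,u)` of `K[[t]]`. -/
noncomputable def uCoeff (i : ℕ) (F : PowerSeries (Polynomial K)) : PowerSeries K :=
  PowerSeries.mk fun n => (PowerSeries.coeff n F).coeff i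

/-- The divided difference `Δ F(u) = (F(u) - F(0)) / u` on `K[u][[t]]`. The division is performed
on each coefficient of `t^n`; see `uVar_mul_divDiff`. -/
noncomputable def divDiff (F : PowerSeries (Polynomial K)) : PowerSeries (Polynomial K) :=
  PowerSeries.mk fun n => (PowerSeries.coeff n F).divX

/-- `u * Δ F(u) = F(u) - F(0)`, where `F(0) = [u^0] F` is viewed in `K[u][[t]]`. -/
theorem uVar_mul_divDiff (F : PowerSeries (Polynomial K)) :
    uVar K * divDiff F = F - PowerSeries.map Polynomial.C (uCoeff 0 F) := by
  ext1 n
  simp only [uVar, divDiff, uCoeff, PowerSeries.coeff_C_mul, PowerSeries.coeff_mk, map_sub,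
    PowerSeries.coeff_map]
  exact eq_sub_of_add_eq (Polynomial.X_mul_divX_add _)

/-- `F` satisfies `F(u) = F₀(u) + t Q(F(u), Δ F(u), …, Δ^(k) F(u), t, u)`. The indeterminates
of `Q` are `y_0, …, y_k` (left summand) and `t, v` (right summand, in this order). -/
def IsSolution {k : ℕ} (F₀ : Polynomial K) (Q : MvPolynomial (Fin (k + 1) ⊕ Fin 2) K)
    (F : PowerSeries (Polynomial K)) : Prop :=
  F = PowerSeries.C F₀ + tVar K *
    MvPolynomial.aeval
      (Sum.elim (fun i : Fin (k + 1) => divDiff^[(i : ℕ)] F) ![tVar K, uVar K]) Q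

/-- `a` is algebraic over the field `K(s)`, the subfield of the fraction field of the
`K`-algebra `A` generated by `K` and `s`. -/
def IsAlgebraicOver (K : Type*) [Field K] {A : Type*} [CommRing A] [IsDomain A] [Algebra K A]
    (s : Set A) (a : A) : Prop :=
  IsAlgebraic (IntermediateField.adjoin K (algebraMap A (FractionRing A) '' s))
    (algebraMap A (FractionRing A) a)

end Catalytic

namespace Catalytic

section Minors

variable {ι κ R R' : Type*} [CommRing R] [IsDomain R] [CommRing R'] [IsDomain R']

theorem exists_det_ne_zero_of_linearIndependent_field {L : Type*} [Field L] [Fintype ι]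
    [DecidableEq ι] {v : ι → κ → L} (hv : LinearIndependent L v) :
    ∃ e : ι → κ, (Matrix.of fun i j => v i (e j)).det ≠ 0 := by
  have hspan : Submodule.span L (Set.range fun k i => v i k) = ⊤ := by
    by_contra hne
    obtain ⟨f, hf, hker⟩ := Submodule.exists_le_ker_of_lt_top _ (lt_top_iff_ne_top.2 hne)
    have hrel : ∑ i, f (Pi.single i 1) • v i = 0 := by
      ext k
      have hk : f (fun i => v i k) = 0 := hker (Submodule.subset_span ⟨k, rfl⟩)
      rw [LinearMap.pi_apply_eq_sum_univ] at hk
      simpa [mul_comm, ← Pi.single_apply, Pi.single_comm] using hk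
    refine hf (LinearMap.pi_ext' fun i => LinearMap.ext_ring ?_)
    exact Fintype.linearIndependent_iff.1 hv _ hrel i
  obtain ⟨μ, a, -, hμ, hli⟩ := exists_linearIndependent' L fun k i => v i k
  let b := Module.Basis.mk hli (hμ.trans hspan).ge
  let σ : ι ≃ μ := (Pi.basisFun L ι).indexEquiv b
  refine ⟨a ∘ σ, ?_⟩
  rw [← isUnit_iff_ne_zero, ← Matrix.isUnit_iff_isUnit_det,
    ← Matrix.linearIndependent_cols_iff_isUnit]
  exact hli.comp σ σ.injective

theorem linearIndependent_iff_exists_det_ne_zero [Fintype ι] [DecidableEq ι] {v : ι → κ → R} :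
    LinearIndependent R v ↔ ∃ e : ι → κ, (Matrix.of fun i j => v i (e j)).det ≠ 0 := by
  constructor
  · intro hv
    let L := FractionRing R
    have hinj := IsFractionRing.injective R L
    have hvL : LinearIndependent R fun i k => algebraMap R L (v i k) :=
      hv.map' ((Algebra.linearMap R L).compLeft κ)
        (LinearMap.ker_eq_bot.2 hinj.comp_left)
    obtain ⟨e, he⟩ := exists_det_ne_zero_of_linearIndependent_field
      ((LinearIndependent.iff_fractionRing R L).1 hvL)
    refine ⟨e, fun h => he ?_⟩
    rw [← map_zero (algebraMap R L), ← h, RingHom.map_det]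
    rfl
  · rintro ⟨e, he⟩
    exact (Matrix.linearIndependent_rows_of_det_ne_zero he).of_comp (LinearMap.funLeft R R e)

theorem linearIndependent_of_linearIndependent_map (φ : R →+* R') {v : ι → κ → R}
    (hv : LinearIndependent R' fun i k => φ (v i k)) : LinearIndependent R v := by
  classical
  rw [linearIndependent_iff_finset_linearIndependent] at hv ⊢
  intro s
  obtain ⟨e, he⟩ := linearIndependent_iff_exists_det_ne_zero.1 (hv s)
  refine linearIndependent_iff_exists_det_ne_zero.2 ⟨e, fun h => he ?_⟩
  rw [← map_zero φ, ← h, RingHom.map_det]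
  rfl

theorem linearIndependent_map_iff {φ : R →+* R'} (hφ : Function.Injective φ) {v : ι → κ → R} :
    LinearIndependent R' (fun i k => φ (v i k)) ↔ LinearIndependent R v := by
  classical
  refine ⟨linearIndependent_of_linearIndependent_map φ, fun hv => ?_⟩
  rw [linearIndependent_iff_finset_linearIndependent] at hv ⊢
  intro s
  obtain ⟨e, he⟩ := linearIndependent_iff_exists_det_ne_zero.1 (hv s)
  refine linearIndependent_iff_exists_det_ne_zero.2 ⟨e, fun h => he (hφ ?_)⟩
  rw [map_zero, ← h, RingHom.map_det]
  rfl

end Minors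

open PowerSeries

section PowerSeriesAlgebraic

variable {R R' : Type*} [CommRing R] [CommRing R']

theorem algebraMap_polynomial_powerSeries (p : Polynomial R) :
    algebraMap (Polynomial R) R⟦X⟧ p = p := by
  rw [PowerSeries.algebraMap_apply', Algebra.algebraMap_self, map_id]
  rfl

instance : FaithfulSMul (Polynomial R) R⟦X⟧ := by
  rw [faithfulSMul_iff_algebraMap_injective]
  intro p q h
  rw [algebraMap_polynomial_powerSeries, algebraMap_polynomial_powerSeries] at h
  exact Polynomial.coe_injective R h

instance {S : Type*} [CommRing S] [Algebra S R] : IsScalarTower S (Polynomial R) R⟦X⟧ :=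
  .of_algebraMap_eq fun s => by
    rw [algebraMap_polynomial_powerSeries, Polynomial.algebraMap_apply, Polynomial.coe_C,
      PowerSeries.algebraMap_apply]

theorem linearIndependent_iff_coeff {ι : Type*} {G : ι → R⟦X⟧} :
    LinearIndependent R G ↔ LinearIndependent R fun i n => coeff n (G i) := by
  let coeffs : R⟦X⟧ →ₗ[R] ℕ → R := LinearMap.pi coeff
  have hcoeffs : LinearMap.ker coeffs = ⊥ :=
    LinearMap.ker_eq_bot.2 fun F G h => PowerSeries.ext (congrFun h)
  exact (coeffs.linearIndependent_iff hcoeffs).symm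

theorem transcendental_iff_linearIndependent_monomials {F : R⟦X⟧} :
    Transcendental (Polynomial R) F ↔
      LinearIndependent R fun m : ℕ × ℕ => (X : R⟦X⟧) ^ m.1 * F ^ m.2 := by
  let b := (Polynomial.basisMonomials R).smulTower (Polynomial.basisMonomials (Polynomial R))
  let f : Polynomial (Polynomial R) →ₗ[R] R⟦X⟧ :=
    (Polynomial.aeval F).toLinearMap.restrictScalars R
  have hfb : f ∘ b = fun m : ℕ × ℕ => (X : R⟦X⟧) ^ m.1 * F ^ m.2 := by
    ext1 ⟨i, j⟩
    change Polynomial.aeval F (b (i, j)) = _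
    simp [b, Module.Basis.smulTower_apply, Polynomial.aeval_monomial, Algebra.smul_def,
      algebraMap_polynomial_powerSeries, X_pow_eq]
  rw [transcendental_iff_injective, ← hfb]
  refine ⟨fun hinj => b.linearIndependent.map' f (LinearMap.ker_eq_bot.2 hinj), fun hli => ?_⟩
  have hinj : Function.Injective f := by
    rw [← b.constr_self R f]
    exact b.injective_constr_of_linearIndependent hli
  exact hinj

theorem coeff_X_pow_mul_map_pow (φ : R →+* R') (F : R⟦X⟧) (i j n : ℕ) :
    coeff n (X ^ i * map φ F ^ j) = φ (coeff n (X ^ i * F ^ j)) := by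
  rw [← coeff_map, map_mul (map φ), map_pow (map φ), map_pow (map φ), map_X]

variable [IsDomain R] [IsDomain R']

theorem isAlgebraic_map (φ : R →+* R') {F : R⟦X⟧} (hF : IsAlgebraic (Polynomial R) F) :
    IsAlgebraic (Polynomial R') (map φ F) := by
  contrapose! hF
  change Transcendental _ _ at hF
  change Transcendental _ _
  rw [transcendental_iff_linearIndependent_monomials, linearIndependent_iff_coeff] at hF ⊢
  simp only [coeff_X_pow_mul_map_pow] at hF
  exact linearIndependent_of_linearIndependent_map φ hF

theorem isAlgebraic_map_iff {φ : R →+* R'} (hφ : Function.Injective φ) {F : R⟦X⟧} :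
    IsAlgebraic (Polynomial R') (map φ F) ↔ IsAlgebraic (Polynomial R) F := by
  rw [← not_iff_not]
  change Transcendental _ _ ↔ Transcendental _ _
  simp only [transcendental_iff_linearIndependent_monomials, linearIndependent_iff_coeff,
    coeff_X_pow_mul_map_pow, linearIndependent_map_iff hφ]

end PowerSeriesAlgebraic

section FixedPoint

variable {R M : Type*} [CommRing R] [AddCommGroup M] [Module R M] (I : Ideal R)

theorem iterate_smodEq_iterate {Φ : M → M}
    (hΦ : ∀ n F G, F ≡ G [SMOD (I ^ n • ⊤ : Submodule R M)] →
      Φ F ≡ Φ G [SMOD (I ^ (n + 1) • ⊤ : Submodule R M)])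
    (n : ℕ) (F G : M) : Φ^[n] F ≡ Φ^[n] G [SMOD (I ^ n • ⊤ : Submodule R M)] := by
  induction n with
  | zero => simp
  | succ n ih =>
    rw [Function.iterate_succ_apply', Function.iterate_succ_apply']
    exact hΦ n _ _ ih

theorem existsUnique_eq_of_contracting [IsAdicComplete I M] {Φ : M → M}
    (hΦ : ∀ n F G, F ≡ G [SMOD (I ^ n • ⊤ : Submodule R M)] →
      Φ F ≡ Φ G [SMOD (I ^ (n + 1) • ⊤ : Submodule R M)]) :
    ∃! F, F = Φ F := by
  have hiter := iterate_smodEq_iterate I hΦ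
  obtain ⟨F, hF⟩ := IsPrecomplete.prec (I := I) inferInstance (f := fun n => Φ^[n] 0)
    fun {m n} hmn => by
      rw [← Nat.add_sub_cancel' hmn, Function.iterate_add_apply]
      exact hiter m _ _
  refine ⟨F, (IsHausdorff.eq_iff_smodEq (I := I)).2 fun n => ?_, fun G hG => ?_⟩
  · have hstep : Φ^[n + 1] 0 ≡ Φ F [SMOD (I ^ (n + 1) • ⊤ : Submodule R M)] := by
      rw [Function.iterate_succ_apply']
      exact hΦ n _ _ (hF n)
    exact ((hF (n + 1)).symm.trans hstep).mono
      (Submodule.smul_mono_left (Ideal.pow_le_pow_right n.le_succ))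
  · refine (IsHausdorff.eq_iff_smodEq (I := I)).2 fun n => ?_
    have hGn : Φ^[n] G = G := Function.iterate_fixed hG.symm n
    rw [← hGn]
    exact (hiter n G 0).trans (hF n)

end FixedPoint

section CatalyticEquation

variable {R R' Z Z' : Type*} {k : ℕ}

/-- The point `(y_0, …, y_k, t, u)`, indexed in the same way as the indeterminates of the
polynomial `Q` of a catalytic equation. -/
def equationPoint (k : ℕ) (y : ℕ → Z) (t u : Z) : Fin (k + 1) ⊕ Fin 2 → Z :=
  Sum.elim (fun i : Fin (k + 1) => y i) ![t, u]

theorem apply_equationPoint (φ : Z → Z') (y : ℕ → Z) (t u : Z) (i : Fin (k + 1) ⊕ Fin 2) :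
    φ (equationPoint k y t u i) = equationPoint k (fun j => φ (y j)) (φ t) (φ u) i := by
  rcases i with i | i
  · rfl
  · fin_cases i <;> rfl

variable [CommRing R] [CommRing R'] [CommRing Z]

/-- The divided difference with respect to `u` on `R[u][[t]]`; it extends `divDiff` from fields to
commutative rings. -/
noncomputable def dividedDifference (F : (Polynomial R)⟦X⟧) : (Polynomial R)⟦X⟧ :=
  mk fun n => (coeff n F).divX

/-- `F` satisfies `F(u) = F₀(u) + t Q(F(u), Δ F(u), …, Δ^(k) F(u), t, u)` over `R`; it extends
`IsSolution` from fields to commutative rings. -/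
def IsCatalyticSolution (F₀ : Polynomial R) (Q : MvPolynomial (Fin (k + 1) ⊕ Fin 2) R)
    (F : (Polynomial R)⟦X⟧) : Prop :=
  F = C F₀ + X * MvPolynomial.aeval
    (equationPoint k (fun i => dividedDifference^[i] F) X (C Polynomial.X)) Q

theorem coeff_coeff_iterate_dividedDifference (F : (Polynomial R)⟦X⟧) (i n m : ℕ) :
    (coeff n (dividedDifference^[i] F)).coeff m = (coeff n F).coeff (m + i) := by
  induction i generalizing m with
  | zero => simp
  | succ i ih =>
    rw [Function.iterate_succ_apply', dividedDifference, coeff_mk, Polynomial.coeff_divX, ih,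
      add_assoc, add_comm 1 i]

theorem X_pow_dvd_iterate_dividedDifference_sub {n : ℕ} {F G : (Polynomial R)⟦X⟧}
    (h : X ^ n ∣ F - G) (i : ℕ) :
    X ^ n ∣ dividedDifference^[i] F - dividedDifference^[i] G := by
  rw [X_pow_dvd_iff] at h ⊢
  intro m hm
  have hcoeff := h m hm
  rw [map_sub, sub_eq_zero] at hcoeff ⊢
  ext l
  rw [coeff_coeff_iterate_dividedDifference, coeff_coeff_iterate_dividedDifference, hcoeff]

theorem dvd_mvAeval_sub_mvAeval {σ : Type*} [Algebra R Z] {z : Z} {y y' : σ → Z}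
    (h : ∀ i, z ∣ y i - y' i) (Q : MvPolynomial σ R) :
    z ∣ MvPolynomial.aeval y Q - MvPolynomial.aeval y' Q := by
  let π := Ideal.Quotient.mkₐ R (Ideal.span {z})
  have hπ : ∀ a b : Z, z ∣ a - b ↔ π a = π b := fun a b => by
    rw [← Ideal.mem_span_singleton, ← Ideal.Quotient.mk_eq_mk_iff_sub_mem]
    rfl
  simp only [hπ] at h ⊢
  rw [← AlgHom.comp_apply, ← AlgHom.comp_apply, MvPolynomial.comp_aeval, MvPolynomial.comp_aeval]
  simp only [h]

theorem smodEq_span_X_pow_iff {n : ℕ} {F G : R⟦X⟧} :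
    F ≡ G [SMOD (Ideal.span {(X : R⟦X⟧)} ^ n • ⊤ : Submodule R⟦X⟧ R⟦X⟧)] ↔ X ^ n ∣ F - G := by
  rw [SModEq.sub_mem, smul_eq_mul, Ideal.mul_top, Ideal.span_singleton_pow,
    Ideal.mem_span_singleton]

theorem existsUnique_isCatalyticSolution (F₀ : Polynomial R)
    (Q : MvPolynomial (Fin (k + 1) ⊕ Fin 2) R) : ∃! F, IsCatalyticSolution F₀ Q F := by
  refine existsUnique_eq_of_contracting (Ideal.span {(X : (Polynomial R)⟦X⟧)}) fun n F G h => ?_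
  rw [smodEq_span_X_pow_iff] at h ⊢
  rw [add_sub_add_left_eq_sub, ← mul_sub, pow_succ']
  refine mul_dvd_mul_left _ (dvd_mvAeval_sub_mvAeval ?_ Q)
  rintro (i | i)
  · exact X_pow_dvd_iterate_dividedDifference_sub h i
  · simp [equationPoint]

theorem map_iterate_dividedDifference (φ : R →+* R') (F : (Polynomial R)⟦X⟧) (i : ℕ) :
    map (Polynomial.mapRingHom φ) (dividedDifference^[i] F) =
      dividedDifference^[i] (map (Polynomial.mapRingHom φ) F) := by
  ext n m
  simp [coeff_coeff_iterate_dividedDifference]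

theorem IsCatalyticSolution.map {F₀ : Polynomial R} {Q : MvPolynomial (Fin (k + 1) ⊕ Fin 2) R}
    {F : (Polynomial R)⟦X⟧} (hF : IsCatalyticSolution F₀ Q F) (φ : R →+* R') :
    IsCatalyticSolution (F₀.map φ) (MvPolynomial.map φ Q)
      (PowerSeries.map (Polynomial.mapRingHom φ) F) := by
  have hmap := congrArg (PowerSeries.map (Polynomial.mapRingHom φ)) hF
  rw [map_add, map_mul, map_C, map_X, MvPolynomial.aeval_def, MvPolynomial.hom_eval₂] at hmap
  simp only [apply_equationPoint, map_iterate_dividedDifference] at hmap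
  rw [IsCatalyticSolution, MvPolynomial.aeval_def, MvPolynomial.eval₂_map]
  refine hmap.trans ?_
  congr 3
  · ext r : 1
    simp [PowerSeries.algebraMap_apply]
  · simp

theorem IsCatalyticSolution.coeff_zero {F₀ : Polynomial R}
    {Q : MvPolynomial (Fin (k + 1) ⊕ Fin 2) R} {F : (Polynomial R)⟦X⟧}
    (hF : IsCatalyticSolution F₀ Q F) : coeff 0 F = F₀ := by
  rw [hF]
  simp

/-- In an `R`-algebra, `y` is a sequence of iterated divided differences with respect to `u`, with
subtracted terms `f`, and `y 0` solves the catalytic equation. Both `K[u][[t]]` and `K[[t]][[u]]`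
give instances. -/
structure IsCatalyticSequence [Algebra R Z] (F₀ : Polynomial R)
    (Q : MvPolynomial (Fin (k + 1) ⊕ Fin 2) R) (t u : Z) (y f : ℕ → Z) : Prop where
  mul_succ : ∀ i, u * y (i + 1) = y i - f i
  zero_eq : y 0 = Polynomial.aeval u F₀ + t * MvPolynomial.aeval (equationPoint k y t u) Q

theorem IsCatalyticSequence.map [CommRing Z'] [Algebra R Z] [Algebra R Z'] {F₀ : Polynomial R}
    {Q : MvPolynomial (Fin (k + 1) ⊕ Fin 2) R} {t u : Z} {y f : ℕ → Z}
    (h : IsCatalyticSequence F₀ Q t u y f) (φ : Z →ₐ[R] Z') :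
    IsCatalyticSequence F₀ Q (φ t) (φ u) (fun i => φ (y i)) (fun i => φ (f i)) where
  mul_succ i := by rw [← map_mul, h.mul_succ, map_sub]
  zero_eq := by
    rw [h.zero_eq, map_add, map_mul, ← Polynomial.aeval_algHom_apply,
      MvPolynomial.comp_aeval_apply]
    simp only [apply_equationPoint]

end CatalyticEquation

section Swap

variable {R : Type*} [CommRing R]

/-- Exchange of the two variables, `R[u][[t]] → R[[t]][[u]]`. -/
noncomputable def swapHom (R : Type*) [CommRing R] : (Polynomial R)⟦X⟧ →ₐ[R] R⟦X⟧⟦X⟧ where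
  toFun F := mk fun i => mk fun n => (coeff n F).coeff i
  map_zero' := by ext; simp
  map_one' := by
    ext i n
    simp only [coeff_mk, coeff_one]
    split_ifs <;> simp_all [Polynomial.coeff_one, coeff_one]
  map_add' F G := by ext; simp
  map_mul' F G := by
    ext i n
    simp only [coeff_mk, coeff_mul, map_sum, Polynomial.finsetSum_coeff, Polynomial.coeff_mul]
    exact Finset.sum_comm
  commutes' r := by
    ext i n
    simp only [PowerSeries.algebraMap_apply, coeff_mk, coeff_C]
    split_ifs <;> simp_all [Polynomial.coeff_C, coeff_C]

theorem coeff_coeff_swapHom (F : (Polynomial R)⟦X⟧) (i n : ℕ) :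
    coeff n (coeff i (swapHom R F)) = (coeff n F).coeff i := by
  simp [swapHom]

theorem swapHom_X : swapHom R X = C X := by
  ext i n
  rw [coeff_coeff_swapHom, coeff_X, coeff_C]
  split_ifs <;> simp_all [coeff_X, Polynomial.coeff_one]

theorem swapHom_C_X : swapHom R (C Polynomial.X) = X := by
  ext i n
  rw [coeff_coeff_swapHom, coeff_X, coeff_C]
  split_ifs <;> simp_all [coeff_one, Polynomial.coeff_X, eq_comm]

theorem swapHom_map_C (f : R⟦X⟧) : swapHom R (map Polynomial.C f) = C f := by
  ext i n
  rw [coeff_coeff_swapHom, coeff_map, coeff_C, Polynomial.coeff_C]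
  split_ifs <;> simp

end Swap

section Derivation

theorem formallyEtale_of_isAlgebraic (R L : Type*) [CommRing R] [IsDomain R] [Field L] [CharZero L]
    [Algebra R L] [FaithfulSMul R L] [Algebra.IsAlgebraic R L] : Algebra.FormallyEtale R L := by
  let : Algebra (FractionRing R) L := FractionRing.liftAlgebra R L
  have : CharZero (FractionRing R) := (algebraMap (FractionRing R) L).charZero
  have : Algebra.IsAlgebraic (FractionRing R) L :=
    (IsFractionRing.comap_isAlgebraic_iff (A := R)).1 inferInstance
  have : Algebra.FormallyEtale (FractionRing R) L := .of_isSeparable _ _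
  have : Algebra.FormallyEtale R (FractionRing R) := .of_isLocalization (nonZeroDivisors R)
  exact .comp R (FractionRing R) L

theorem exists_derivation_extends (R : Type*) {S T : Type*} [CommRing R] [CommRing S] [CommRing T]
    [Algebra R S] [Algebra R T] [Algebra S T] [IsScalarTower R S T] [Algebra.FormallyEtale S T]
    (d : Derivation R S T) : ∃ D : Derivation R T T, ∀ s, D (algebraMap S T s) = d s := by
  let e := KaehlerDifferential.tensorKaehlerEquivOfFormallyEtale R S T
  let extension := (d.liftKaehlerDifferential.liftBaseChange T) ∘ₗ e.symm.toLinearMap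
  refine ⟨extension.compDer (KaehlerDifferential.D R T), fun s => ?_⟩
  have he : e.symm (KaehlerDifferential.D R T (algebraMap S T s)) = _ :=
    KaehlerDifferential.tensorKaehlerEquivOfFormallyEtale_symm_D_algebraMap R S T s
  simp [extension, he]

variable {R L : Type*} [CommRing R] [IsDomain R] [Field L] [CharZero L] [Algebra R L]

theorem exists_derivation_of_isTranscendenceBasis {ι : Type*} {v : ι → L}
    (hv : IsTranscendenceBasis R v) (d : ι → L) :
    ∃ D : Derivation R L L, ∀ i, D (v i) = d i := by
  let : Algebra (MvPolynomial ι R) L := (MvPolynomial.aeval v).toRingHom.toAlgebra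
  have hX : ∀ i, algebraMap (MvPolynomial ι R) L (.X i) = v i := MvPolynomial.aeval_X v
  have : FaithfulSMul (MvPolynomial ι R) L :=
    (faithfulSMul_iff_algebraMap_injective _ _).2 hv.1
  have : Algebra.IsAlgebraic (MvPolynomial ι R) L :=
    hv.isAlgebraic_iff.2 fun i => hX i ▸ isAlgebraic_algebraMap _
  have := formallyEtale_of_isAlgebraic (MvPolynomial ι R) L
  obtain ⟨D, hD⟩ := exists_derivation_extends R (MvPolynomial.mkDerivation R d)
  exact ⟨D, fun i => by rw [← hX, hD, MvPolynomial.mkDerivation_X]⟩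

theorem exists_derivation_ne_zero {x : L} (hx : Transcendental R x) :
    ∃ D : Derivation R L L, D x ≠ 0 := by
  have hind : AlgebraicIndepOn R id ({x} : Set L) :=
    algebraicIndependent_unique_type_iff.2 hx
  obtain ⟨B, hxB, hB⟩ := exists_isTranscendenceBasis_superset hind
  obtain ⟨D, hD⟩ := exists_derivation_of_isTranscendenceBasis hB 1
  exact ⟨D, by simpa using (hD ⟨x, hxB rfl⟩).trans_ne one_ne_zero⟩

theorem derivation_eq_zero_of_isAlgebraic {R Z N : Type*} [CommRing R] [IsDomain R] [CharZero R]
    [CommRing Z] [Algebra R Z] [FaithfulSMul R Z] [AddCommGroup N] [Module R N] [Module Z N]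
    [IsDomain Z] [Module.IsTorsionFree Z N] (D : Derivation R Z N) {x : Z}
    (hx : IsAlgebraic R x) : D x = 0 := by
  obtain ⟨p, hp, hpx⟩ := hx
  induction hn : p.natDegree using Nat.strong_induction_on generalizing p with
  | _ n ih =>
    have hdeg : p.natDegree ≠ 0 := fun h => by
      rw [Polynomial.eq_C_of_natDegree_eq_zero h, Polynomial.aeval_C,
        FaithfulSMul.algebraMap_eq_zero_iff] at hpx
      exact hp (by rw [Polynomial.eq_C_of_natDegree_eq_zero h, hpx, map_zero])
    have hD : Polynomial.aeval x p.derivative • D x = 0 := by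
      rw [← D.map_aeval, hpx, map_zero]
    refine (smul_eq_zero.1 hD).elim (fun hp'x => ?_) id
    refine ih _ (hn ▸ Polynomial.natDegree_derivative_lt hdeg) _ (fun hp' => ?_) hp'x rfl
    exact hdeg (Polynomial.derivative_eq_zero.1 hp')

end Derivation

section KernelMethod

variable {k : ℕ} {Z N : Type*} [CommRing Z] [AddCommGroup N] [Module Z N]

/-- The sum of the terms of index at least `j` of `∑ i ≤ k, q i * u ^ (k - i)`. With
`q i = ∂Q/∂y_i`, the kernel of the catalytic equation is `u ^ k - t * kernelSum q u 0`. -/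
def kernelSum (q : Fin (k + 1) → Z) (u : Z) (j : ℕ) : Z :=
  ∑ i : Fin (k + 1) with j ≤ i.val, q i * u ^ (k - (i : ℕ))

theorem map_kernelSum {Z' : Type*} [CommRing Z'] (φ : Z →+* Z') (q : Fin (k + 1) → Z) (u : Z)
    (j : ℕ) : φ (kernelSum q u j) = kernelSum (fun i => φ (q i)) (φ u) j := by
  simp only [kernelSum, map_sum, map_mul, map_pow]

theorem kernelSum_zero_right (q : Fin (k + 1) → Z) {j : ℕ} (hj : j ≤ k) :
    kernelSum q 0 j = q (Fin.last k) := by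
  rw [kernelSum, Finset.sum_eq_single (Fin.last k)]
  · simp
  · intro i _ hi
    rw [zero_pow (Nat.sub_ne_zero_of_lt (Fin.val_lt_last hi)), mul_zero]
  · simp [hj]

theorem pow_smul_eq_sub_sum {u : Z} {d e : ℕ → N} (h : ∀ i, u • d (i + 1) = d i - e i) (i : ℕ) :
    u ^ i • d i = d 0 - ∑ j ∈ Finset.range i, u ^ j • e j := by
  induction i with
  | zero => simp
  | succ i ih =>
    rw [pow_succ, mul_smul, h, smul_sub, ih, Finset.sum_range_succ, sub_sub]

theorem pow_smul_sum_eq_kernelSum_smul_sub {u : Z} {d e : ℕ → N}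
    (h : ∀ i, u • d (i + 1) = d i - e i) (q : Fin (k + 1) → Z) :
    u ^ k • ∑ i, q i • d i =
      kernelSum q u 0 • d 0 - ∑ j : Fin k, (u ^ (j : ℕ) * kernelSum q u (j + 1)) • e j := by
  calc u ^ k • ∑ i, q i • d i
      = ∑ i : Fin (k + 1), (q i * u ^ (k - i : ℕ)) •
          (d 0 - ∑ j ∈ Finset.range i, u ^ j • e j) := by
        rw [Finset.smul_sum]
        refine Finset.sum_congr rfl fun i _ => ?_
        rw [← pow_smul_eq_sub_sum h, smul_smul, smul_smul, mul_assoc, ← pow_add,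
          Nat.sub_add_cancel i.is_le, mul_comm]
    _ = kernelSum q u 0 • d 0 -
          ∑ j ∈ Finset.range k, (u ^ j * kernelSum q u (j + 1)) • e j := by
        simp only [smul_sub, Finset.sum_sub_distrib, Finset.smul_sum, smul_smul, kernelSum,
          Finset.mul_sum, Finset.sum_smul, Nat.zero_le, Finset.filter_true]
        congr 1
        rw [Finset.sum_comm' (t' := Finset.range k) (s' := fun j => {i | j + 1 ≤ i.val})
          fun i j => by grind]
        simp only [mul_comm]
    _ = _ := by rw [Finset.sum_range]

variable {R : Type*} [CommRing R] [Algebra R Z] [Module R N]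

theorem derivation_mvAeval {σ : Type*} [Fintype σ] (δ : Derivation R Z N) (y : σ → Z)
    (Q : MvPolynomial σ R) :
    δ (MvPolynomial.aeval y Q) =
      ∑ i, MvPolynomial.aeval y (MvPolynomial.pderiv i Q) • δ (y i) := by
  classical
  induction Q using MvPolynomial.induction_on with
  | C a => simp
  | add p q hp hq => simp [hp, hq, add_smul, Finset.sum_add_distrib]
  | mul_X p i hp =>
    simp only [map_mul, MvPolynomial.aeval_X, Derivation.leibniz, hp, smul_eq_mul, map_add,
      MvPolynomial.pderiv_X, add_smul, Finset.sum_add_distrib, Finset.smul_sum, mul_smul]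
    congr 1
    simp [Pi.single_apply]

theorem IsCatalyticSequence.kernel_smul_derivation {F₀ : Polynomial R}
    {Q : MvPolynomial (Fin (k + 1) ⊕ Fin 2) R} {t u : Z} {y f : ℕ → Z}
    (h : IsCatalyticSequence F₀ Q t u y f) {q : Fin (k + 1) → Z}
    (hq : ∀ i, q i = MvPolynomial.aeval (equationPoint k y t u) (MvPolynomial.pderiv (.inl i) Q))
    (δ : Derivation R Z N) (ht : δ t = 0) (hu : δ u = 0) :
    (u ^ k - t * kernelSum q u 0) • δ (y 0) =
      -(t • ∑ j : Fin k, (u ^ (j : ℕ) * kernelSum q u (j + 1)) • δ (f j)) := by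
  have hstep : ∀ i, u • δ (y (i + 1)) = δ (y i) - δ (f i) := fun i => by
    rw [← map_sub, ← h.mul_succ, Derivation.leibniz, hu, smul_zero, add_zero]
  have hy₀ : δ (y 0) = t • ∑ i, q i • δ (y i) := by
    conv_lhs => rw [h.zero_eq]
    simp [Derivation.map_aeval, Derivation.leibniz, derivation_mvAeval, equationPoint, hu, ht, hq]
  calc (u ^ k - t * kernelSum q u 0) • δ (y 0)
      = t • u ^ k • ∑ i, q i • δ (y i) - t • kernelSum q u 0 • δ (y 0) := by
        rw [sub_smul, mul_smul, smul_comm t (u ^ k), ← hy₀]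
    _ = _ := by
        rw [pow_smul_sum_eq_kernelSum_smul_sub (d := fun i => δ (y i)) (e := fun j => δ (f j))
          hstep, ← smul_sub, sub_sub_cancel_left, smul_neg]

theorem exists_derivation_powerSeries_extends {A L : Type*} [CommRing A] [Algebra R A] [Field L]
    [CharZero L] [IsDomain A] [Algebra R L] [Algebra A L] [Algebra A⟦X⟧ L] [IsScalarTower R A L]
    [IsScalarTower A A⟦X⟧ L] [IsScalarTower R A⟦X⟧ L]
    [FaithfulSMul A L] [Algebra.IsAlgebraic A L] (d : Derivation R A L) :
    ∃ δ : Derivation R A⟦X⟧ L, δ X = 0 ∧ ∀ a, δ (C a) = d a := by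
  have := formallyEtale_of_isAlgebraic A L
  obtain ⟨D, hD⟩ := exists_derivation_extends R d
  have hDC : ∀ a, D (algebraMap A⟦X⟧ L (C a)) = d a := fun a => by
    rw [← hD, IsScalarTower.algebraMap_apply A A⟦X⟧ L]
    rfl
  let DX : Derivation R A⟦X⟧ L :=
    (LinearMap.toSpanSingleton A⟦X⟧ L (D (algebraMap A⟦X⟧ L X))).compDer
      ((derivative A).restrictScalars R)
  have hDX : ∀ F, DX F = derivative A F • D (algebraMap A⟦X⟧ L X) := fun F => rfl
  refine ⟨D.compAlgebraMap A⟦X⟧ - DX, ?_, fun a => ?_⟩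
  · rw [Derivation.sub_apply, hDX, derivative_X, one_smul]
    exact sub_self _
  · rw [Derivation.sub_apply, hDX, derivative_C, zero_smul, sub_zero]
    exact hDC a

end KernelMethod

section TotallyRamified

variable {B : Type*} [CommRing B] [IsDomain B] {π : B}

theorem sum_pow_mul_ne_zero_of_injOn (hπ₀ : π ≠ 0) (hπ : ¬ IsUnit π) {ι : Type*} {s : Finset ι}
    (hs : s.Nonempty) {n : ι → ℕ} (hn : Set.InjOn n s) {v : ι → B} (hv : ∀ i ∈ s, IsUnit (v i)) :
    ∑ i ∈ s, π ^ n i * v i ≠ 0 := by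
  classical
  intro hsum
  obtain ⟨i, hi, hmin⟩ := s.exists_min_image n hs
  have hdvd : π ^ (n i + 1) ∣ ∑ j ∈ s.erase i, π ^ n j * v j := by
    refine Finset.dvd_sum fun j hj => (pow_dvd_pow π ?_).mul_right _
    obtain ⟨hji, hj⟩ := Finset.mem_erase.1 hj
    exact (hmin j hj).lt_of_ne fun h => hji (hn hj hi h.symm)
  rw [← Finset.add_sum_erase _ _ hi, add_eq_zero_iff_eq_neg] at hsum
  rw [← dvd_neg, ← hsum, pow_succ, mul_dvd_mul_iff_left (pow_ne_zero _ hπ₀)] at hdvd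
  exact hπ (isUnit_of_dvd_unit hdvd (hv i hi))

variable {A : Type*} [CommRing A] [IsDomain A] [IsDiscreteValuationRing A] [Algebra A B]

theorem linearIndependent_pow_mul_of_totallyRamified (hπ₀ : π ≠ 0) (hπ : ¬ IsUnit π) {ϖ : A}
    (hϖ : Irreducible ϖ) {k : ℕ} {w₀ : B} (hw₀ : IsUnit w₀) (hϖπ : algebraMap A B ϖ = π ^ k * w₀)
    {w : Fin k → B} (hw : ∀ j, IsUnit (w j)) :
    LinearIndependent A fun j : Fin k => π ^ (j : ℕ) * w j := by
  classical
  rw [Fintype.linearIndependent_iff]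
  intro a hsum
  by_contra! hne
  have hfactor : ∀ j, ∃ m : ℕ, ∃ ε : Aˣ, a j ≠ 0 → a j = ε * ϖ ^ m := fun j => by
    by_cases h : a j = 0
    · exact ⟨0, 1, absurd h⟩
    · obtain ⟨m, ε, hε⟩ := IsDiscreteValuationRing.eq_unit_mul_pow_irreducible h hϖ
      exact ⟨m, ε, fun _ => hε⟩
  choose m ε hε using hfactor
  have hterm : ∀ j, a j ≠ 0 → a j • (π ^ (j : ℕ) * w j) =
      π ^ (k * m j + j) * (algebraMap A B (ε j) * w₀ ^ m j * w j) := fun j hj => by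
    rw [hε j hj, Algebra.smul_def, map_mul, map_pow, hϖπ]
    ring
  rw [← Finset.sum_filter_of_ne (p := fun j => a j ≠ 0) fun j _ h h0 => h (by rw [h0, zero_smul]),
    Finset.sum_congr rfl fun j hj => hterm j (Finset.mem_filter.1 hj).2] at hsum
  refine sum_pow_mul_ne_zero_of_injOn hπ₀ hπ ?_ ?_ (fun j _ => ?_) hsum
  · exact hne.imp fun j hj => by simpa using hj
  · intro i _ j _ hij
    have hmod := congrArg (· % k) hij
    simpa [Nat.mod_eq_of_lt, Fin.ext_iff] using hmod
  · exact (((ε j).isUnit.map _).mul (hw₀.pow _)).mul (hw j)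

end TotallyRamified

section KernelQuotient

variable {A : Type*} [CommRing A]

/-- The kernel `u ^ k - ϖ * H` of the catalytic equation, as a power series in `u`. -/
noncomputable def kernelSeries (ϖ : A) (k : ℕ) (H : A⟦X⟧) : A⟦X⟧ := X ^ k - C ϖ * H

theorem not_isUnit_mk_X {ϖ : A} {k : ℕ} {H : A⟦X⟧} (hϖ : ¬ IsUnit ϖ) (hk : k ≠ 0) :
    ¬ IsUnit (Ideal.Quotient.mk (Ideal.span {kernelSeries ϖ k H}) X) := by
  have hle : Ideal.span {kernelSeries ϖ k H} ≤
      RingHom.ker ((Ideal.Quotient.mk (Ideal.span {ϖ})).comp constantCoeff) := by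
    rw [Ideal.span_singleton_le_iff_mem, RingHom.mem_ker]
    simp [kernelSeries, hk]
  intro hX
  have hzero := hX.map (Ideal.Quotient.lift _ _ hle)
  change IsUnit (Ideal.Quotient.mk (Ideal.span {ϖ}) (constantCoeff X)) at hzero
  rw [constantCoeff_X, map_zero, isUnit_zero_iff, ← map_one (Ideal.Quotient.mk _), eq_comm,
    Ideal.Quotient.eq_zero_iff_mem, Ideal.mem_span_singleton] at hzero
  exact hϖ (isUnit_of_dvd_one hzero)

variable [IsDomain A] [IsDiscreteValuationRing A] {ϖ : A}

theorem map_residue_kernelSeries (hϖ : Irreducible ϖ) (k : ℕ) (H : A⟦X⟧) :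
    (kernelSeries ϖ k H).map (IsLocalRing.residue A) = X ^ k := by
  have hres : IsLocalRing.residue A ϖ = 0 := by
    rw [IsLocalRing.residue_eq_zero_iff, hϖ.maximalIdeal_eq]
    exact Ideal.mem_span_singleton_self _
  simp [kernelSeries, hres]

theorem isEisensteinAt_of_kernelSeries (hϖ : Irreducible ϖ) {k : ℕ} (hk : k ≠ 0) {H : A⟦X⟧}
    (hH : IsUnit (constantCoeff H)) {f : Polynomial A} {h : A⟦X⟧}
    (hf : (kernelSeries ϖ k H).IsWeierstrassFactorization f h) :
    f.IsEisensteinAt (IsLocalRing.maximalIdeal A) where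
  leading := by
    rw [hf.isDistinguishedAt.monic.leadingCoeff]
    exact (Ideal.ne_top_iff_one _).1 (IsLocalRing.maximalIdeal.isMaximal _).ne_top
  mem := hf.isDistinguishedAt.mem
  notMem hmem := by
    rw [hϖ.maximalIdeal_eq, Ideal.span_singleton_pow, Ideal.mem_span_singleton] at hmem
    obtain ⟨a, ha⟩ := hmem
    have hcoeff := congrArg constantCoeff hf.eq_mul
    rw [map_mul, ← coeff_zero_eq_constantCoeff_apply (f : A⟦X⟧), Polynomial.coeff_coe, ha] at hcoeff
    simp only [kernelSeries, map_sub, map_pow, constantCoeff_X, zero_pow hk, map_mul,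
      constantCoeff_C, zero_sub] at hcoeff
    have hHϖ : constantCoeff H = ϖ * -(a * constantCoeff h) :=
      mul_left_cancel₀ hϖ.ne_zero (by linear_combination -hcoeff)
    exact hϖ.not_isUnit (isUnit_of_dvd_unit ⟨_, hHϖ⟩ hH)

variable [IsAdicComplete (IsLocalRing.maximalIdeal A) A]

theorem exists_isWeierstrassFactorization_kernelSeries (hϖ : Irreducible ϖ) (k : ℕ) (H : A⟦X⟧) :
    ∃ f h, (kernelSeries ϖ k H).IsWeierstrassFactorization f h ∧ f.natDegree = k := by
  have hres := map_residue_kernelSeries hϖ k H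
  obtain ⟨f, h, hf⟩ := exists_isWeierstrassFactorization (hres ▸ pow_ne_zero k X_ne_zero)
  exact ⟨f, h, hf, by rw [hf.natDegree_eq_toNat_order_map, hres, order_X_pow, ENat.toNat_natCast]⟩

variable {k : ℕ} {H : A⟦X⟧}

theorem isDomain_kernelQuotient (hϖ : Irreducible ϖ) (hk : k ≠ 0) (hH : IsUnit (constantCoeff H)) :
    IsDomain (A⟦X⟧ ⧸ Ideal.span {kernelSeries ϖ k H}) := by
  obtain ⟨f, h, hf, hdeg⟩ := exists_isWeierstrassFactorization_kernelSeries hϖ k H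
  have hirr : Irreducible f := (isEisensteinAt_of_kernelSeries hϖ hk hH hf).irreducible
    inferInstance hf.isDistinguishedAt.monic.isPrimitive (hdeg ▸ Nat.pos_of_ne_zero hk)
  have : (Ideal.span {f}).IsPrime := (Ideal.span_singleton_prime hirr.ne_zero).2 hirr.prime
  exact hf.algEquivQuotient.toMulEquiv.symm.isDomain _

theorem isIntegral_kernelQuotient (hϖ : Irreducible ϖ) :
    Algebra.IsIntegral A (A⟦X⟧ ⧸ Ideal.span {kernelSeries ϖ k H}) := by
  obtain ⟨f, h, hf, -⟩ := exists_isWeierstrassFactorization_kernelSeries hϖ k H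
  have := hf.isDistinguishedAt.monic.finite_quotient
  have : Module.Finite A (A⟦X⟧ ⧸ Ideal.span {kernelSeries ϖ k H}) :=
    .equiv hf.algEquivQuotient.toLinearEquiv
  infer_instance

theorem faithfulSMul_kernelQuotient (hϖ : Irreducible ϖ) (hk : k ≠ 0) :
    FaithfulSMul A (A⟦X⟧ ⧸ Ideal.span {kernelSeries ϖ k H}) := by
  obtain ⟨f, h, hf, hdeg⟩ := exists_isWeierstrassFactorization_kernelSeries hϖ k H
  refine (faithfulSMul_iff_algebraMap_injective A (A⟦X⟧ ⧸ Ideal.span {kernelSeries ϖ k H})).2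
    ((injective_iff_map_eq_zero _).2 fun a ha => ?_)
  rw [← hf.algEquivQuotient.commutes, EmbeddingLike.map_eq_zero_iff] at ha
  have hdvd : f ∣ Polynomial.C a := by
    rwa [← Ideal.mem_span_singleton, ← Ideal.Quotient.eq_zero_iff_mem]
  by_contra ha₀
  have hdeg_le := Polynomial.natDegree_le_of_dvd hdvd (Polynomial.C_ne_zero.2 ha₀)
  rw [Polynomial.natDegree_C, hdeg] at hdeg_le
  exact hk (Nat.le_zero.1 hdeg_le)

theorem linearIndependent_kernelQuotient (hϖ : Irreducible ϖ) (hk : k ≠ 0)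
    (hH : IsUnit (constantCoeff H)) {w : Fin k → A⟦X⟧} (hw : ∀ j, IsUnit (constantCoeff (w j))) :
    LinearIndependent A fun j : Fin k =>
      Ideal.Quotient.mk (Ideal.span {kernelSeries ϖ k H}) (X ^ (j : ℕ) * w j) := by
  have := isDomain_kernelQuotient hϖ hk hH
  have := faithfulSMul_kernelQuotient (H := H) hϖ hk
  set π := Ideal.Quotient.mk (Ideal.span {kernelSeries ϖ k H})
  have hunit : ∀ z : A⟦X⟧, IsUnit (constantCoeff z) → IsUnit (π z) := fun z hz =>
    (isUnit_iff_constantCoeff.2 hz).map π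
  obtain ⟨w₀, hw₀⟩ := (hunit H hH).exists_right_inv
  have hpow : π X ^ k = π (C ϖ) * π H := by
    rw [← map_pow, ← map_mul, Ideal.Quotient.mk_eq_mk_iff_sub_mem]
    exact Ideal.mem_span_singleton_self _
  have hϖπ : algebraMap A _ ϖ = π X ^ k * w₀ := by
    rw [hpow, mul_assoc, hw₀, mul_one]
    rfl
  have hX : π X ≠ 0 := fun hX => hϖ.ne_zero <| by
    rwa [hX, zero_pow hk, zero_mul, FaithfulSMul.algebraMap_eq_zero_iff] at hϖπ
  simp only [map_mul, map_pow]
  exact linearIndependent_pow_mul_of_totallyRamified hX (not_isUnit_mk_X hϖ.not_isUnit hk) hϖ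
    (.of_mul_eq_one_right _ hw₀) hϖπ fun j => hunit _ (hw j)

end KernelQuotient

section CoefficientDerivation

variable {K A : Type*} [CommRing K] [CommRing A] [IsDomain A] [Algebra K A] {ϖ : A} {k : ℕ}
  {F₀ : Polynomial K} {Q : MvPolynomial (Fin (k + 1) ⊕ Fin 2) K} {y : ℕ → A⟦X⟧} {f : ℕ → A}
  {q : Fin (k + 1) → A⟦X⟧} {M : Type*} [Field M] [Algebra A M] [IsFractionRing A M] [Algebra K M]
  [IsScalarTower K A M]

theorem IsCatalyticSequence.derivation_coeff_eq_zero_of_linearIndependent {L : Type*} [Field L]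
    [CharZero L] [Algebra K L] [Algebra M L] [Algebra A L]
    [IsScalarTower A M L] [IsScalarTower K A L] [Algebra A⟦X⟧ L] [IsScalarTower A A⟦X⟧ L]
    [IsScalarTower K A⟦X⟧ L] [Algebra.IsAlgebraic A L]
    (h : IsCatalyticSequence F₀ Q (C ϖ) X y fun i => C (f i))
    (hq : ∀ i, q i =
      MvPolynomial.aeval (equationPoint k y (C ϖ) X) (MvPolynomial.pderiv (.inl i) Q))
    (hϖ : ϖ ≠ 0) (hker : algebraMap A⟦X⟧ L (X ^ k - C ϖ * kernelSum q X 0) = 0)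
    (hli : LinearIndependent A fun j : Fin k =>
      algebraMap A⟦X⟧ L (X ^ (j : ℕ) * kernelSum q X (j + 1)))
    (D : Derivation K A M) (hD : D ϖ = 0) (j : Fin k) : D (f j) = 0 := by
  have : FaithfulSMul A L := by
    rw [faithfulSMul_iff_algebraMap_injective, IsScalarTower.algebraMap_eq A M L]
    exact (algebraMap M L).injective.comp (IsFractionRing.injective A M)
  obtain ⟨δ, hδX, hδC⟩ := exists_derivation_powerSeries_extends
    ((IsScalarTower.toAlgHom A M L).toLinearMap.compDer D)
  replace hδC : ∀ a, δ (C a) = algebraMap M L (D a) := hδC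
  have hkernel := h.kernel_smul_derivation hq δ (by rw [hδC, hD, map_zero]) hδX
  rw [Algebra.smul_def, hker, zero_mul, eq_comm, neg_eq_zero, Algebra.smul_def, mul_eq_zero,
    or_iff_right] at hkernel
  · refine Fintype.linearIndependent_iff.1 ((LinearIndependent.iff_fractionRing A M).1 hli)
      (fun j => D (f j)) (hkernel ▸ Finset.sum_congr rfl fun j _ => ?_) j
    rw [hδC, Algebra.smul_def, Algebra.smul_def, mul_comm]
  · exact (IsScalarTower.algebraMap_apply A A⟦X⟧ L ϖ).symm.trans_ne
      ((FaithfulSMul.algebraMap_eq_zero_iff A L).not.2 hϖ)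

theorem IsCatalyticSequence.derivation_coeff_eq_zero [CharZero A] [IsDiscreteValuationRing A]
    [IsAdicComplete (IsLocalRing.maximalIdeal A) A]
    (h : IsCatalyticSequence F₀ Q (C ϖ) X y fun i => C (f i)) (hϖ : Irreducible ϖ)
    (hQ : IsUnit (constantCoeff (MvPolynomial.aeval (equationPoint k y (C ϖ) X)
      (MvPolynomial.pderiv (.inl (Fin.last k)) Q))))
    (D : Derivation K A (FractionRing A)) (hD : D ϖ = 0) (j : Fin k) : D (f j) = 0 := by
  have hk : k ≠ 0 := fun hk => (hk ▸ j).elim0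
  let q : Fin (k + 1) → A⟦X⟧ := fun i =>
    MvPolynomial.aeval (equationPoint k y (C ϖ) X) (MvPolynomial.pderiv (.inl i) Q)
  have hunit : ∀ m ≤ k, IsUnit (constantCoeff (kernelSum q X m)) := fun m hm => by
    rw [map_kernelSum, constantCoeff_X, kernelSum_zero_right _ hm]
    exact hQ
  let B := A⟦X⟧ ⧸ Ideal.span {kernelSeries ϖ k (kernelSum q X 0)}
  have : IsDomain B := isDomain_kernelQuotient hϖ hk (hunit 0 k.zero_le)
  have : Algebra.IsIntegral A B := isIntegral_kernelQuotient hϖ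
  have : FaithfulSMul A B := faithfulSMul_kernelQuotient hϖ hk
  let L := FractionRing B
  have : CharZero L := charZero_of_injective_algebraMap (FaithfulSMul.algebraMap_injective A L)
  let : Algebra (FractionRing A) L := FractionRing.liftAlgebra A L
  have : Algebra.IsAlgebraic A L := (IsFractionRing.isAlgebraic_iff' A B L).1 inferInstance
  refine h.derivation_coeff_eq_zero_of_linearIndependent (L := L) (fun _ => rfl) hϖ.ne_zero ?_ ?_
    D hD j
  · rw [IsScalarTower.algebraMap_apply A⟦X⟧ B L]
    convert! map_zero (algebraMap B L)
    exact Ideal.Quotient.eq_zero_iff_mem.2 (Ideal.mem_span_singleton_self _)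
  · exact (linearIndependent_kernelQuotient hϖ hk (hunit 0 k.zero_le) fun j => hunit _ j.2).map'
      (IsScalarTower.toAlgHom A B L).toLinearMap
      (LinearMap.ker_eq_bot.2 (IsFractionRing.injective B L))

end CoefficientDerivation

section NondegenerateEquation

variable {k : ℕ}

/-- The value of `P` at `t = u = 0` and `y_i = [u^i] F₀`, which is where the series `Δ^(i) F` take
their constant terms when `F` solves a catalytic equation. -/
noncomputable def evalOrigin {R : Type*} [CommRing R] (F₀ : Polynomial R)
    (P : MvPolynomial (Fin (k + 1) ⊕ Fin 2) R) : R :=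
  MvPolynomial.eval (equationPoint k F₀.coeff 0 0) P

theorem evalOrigin_map {R R' : Type*} [CommRing R] [CommRing R'] (φ : R →+* R')
    (F₀ : Polynomial R) (P : MvPolynomial (Fin (k + 1) ⊕ Fin 2) R) :
    evalOrigin (F₀.map φ) (MvPolynomial.map φ P) = φ (evalOrigin F₀ P) := by
  rw [evalOrigin, evalOrigin, MvPolynomial.map_eval]
  congr 2
  funext i
  rw [Function.comp_apply, apply_equationPoint φ]
  simp only [map_zero, ← Polynomial.coeff_map]

theorem aeval_C_X {R : Type*} [CommRing R] (p : Polynomial R) :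
    Polynomial.aeval (C Polynomial.X : (Polynomial R)⟦X⟧) p = C p := by
  have hC : algebraMap R (Polynomial R)⟦X⟧ = (C (R := Polynomial R)).comp Polynomial.C := by
    ext r : 1
    exact PowerSeries.algebraMap_apply
  rw [Polynomial.aeval_def, hC, ← Polynomial.hom_eval₂, Polynomial.eval₂_C_X]

variable {K : Type*} [Field K] {F₀ : Polynomial K} {Q : MvPolynomial (Fin (k + 1) ⊕ Fin 2) K}
  {F : (Polynomial K)⟦X⟧}

theorem uCoeff_zero_iterate_dividedDifference (F : (Polynomial K)⟦X⟧) (i : ℕ) :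
    uCoeff 0 (dividedDifference^[i] F) = uCoeff i F := by
  ext n
  rw [uCoeff, uCoeff, coeff_mk, coeff_mk, coeff_coeff_iterate_dividedDifference, zero_add]

theorem C_X_mul_iterate_dividedDifference_succ (F : (Polynomial K)⟦X⟧) (i : ℕ) :
    C Polynomial.X * dividedDifference^[i + 1] F =
      dividedDifference^[i] F - map Polynomial.C (uCoeff i F) := by
  rw [Function.iterate_succ_apply', ← uCoeff_zero_iterate_dividedDifference]
  exact uVar_mul_divDiff _

theorem IsCatalyticSolution.isCatalyticSequence (hF : IsCatalyticSolution F₀ Q F) :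
    IsCatalyticSequence F₀ Q X (C Polynomial.X) (fun i => dividedDifference^[i] F)
      fun i => PowerSeries.map Polynomial.C (uCoeff i F) where
  mul_succ := C_X_mul_iterate_dividedDifference_succ F
  zero_eq := by
    rw [aeval_C_X]
    exact hF

theorem IsCatalyticSolution.isCatalyticSequence_swapHom (hF : IsCatalyticSolution F₀ Q F) :
    IsCatalyticSequence F₀ Q (C X) X (fun i => swapHom K (dividedDifference^[i] F))
      fun i => C (uCoeff i F) := by
  simpa only [swapHom_X, swapHom_C_X, swapHom_map_C] using hF.isCatalyticSequence.map (swapHom K)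

theorem IsCatalyticSolution.constantCoeff_constantCoeff_mvAeval (hF : IsCatalyticSolution F₀ Q F)
    (P : MvPolynomial (Fin (k + 1) ⊕ Fin 2) K) :
    constantCoeff (constantCoeff (MvPolynomial.aeval
      (equationPoint k (fun i => swapHom K (dividedDifference^[i] F)) (C X) X) P)) =
      evalOrigin F₀ P := by
  have hy : ∀ i, constantCoeff (constantCoeff (swapHom K (dividedDifference^[i] F))) =
      F₀.coeff i := fun i => by
    rw [← coeff_zero_eq_constantCoeff_apply, ← coeff_zero_eq_constantCoeff_apply,
      coeff_coeff_swapHom, coeff_coeff_iterate_dividedDifference, hF.coeff_zero, zero_add]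
  rw [MvPolynomial.aeval_def, MvPolynomial.hom_eval₂, MvPolynomial.hom_eval₂, evalOrigin,
    MvPolynomial.eval, MvPolynomial.coe_eval₂Hom]
  simp only [apply_equationPoint, hy, constantCoeff_C, constantCoeff_X]
  rfl

variable [CharZero K]

theorem IsCatalyticSolution.isAlgebraic_uCoeff_of_evalOrigin_ne_zero
    (hF : IsCatalyticSolution F₀ Q F)
    (hQ : evalOrigin F₀ (MvPolynomial.pderiv (.inl (Fin.last k)) Q) ≠ 0) (j : Fin k) :
    IsAlgebraic (Polynomial K) (uCoeff j F) := by
  by_contra htr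
  let L := FractionRing K⟦X⟧
  have : CharZero L := charZero_of_injective_algebraMap (FaithfulSMul.algebraMap_injective K L)
  obtain ⟨D, hD⟩ := exists_derivation_ne_zero
    ((transcendental_algebraMap_iff (IsFractionRing.injective K⟦X⟧ L)).2 htr)
  have : IsAdicComplete (IsLocalRing.maximalIdeal K⟦X⟧) K⟦X⟧ := by
    rw [maximalIdeal_eq_span_X]
    infer_instance
  have : CharZero K⟦X⟧ := charZero_of_injective_algebraMap (FaithfulSMul.algebraMap_injective K _)
  refine hD (hF.isCatalyticSequence_swapHom.derivation_coeff_eq_zero X_irreducible ?_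
    ((D.restrictScalars K).compAlgebraMap K⟦X⟧) ?_ j)
  · rw [isUnit_iff_constantCoeff, hF.constantCoeff_constantCoeff_mvAeval]
    exact hQ.isUnit
  · have hX := D.map_algebraMap Polynomial.X
    rwa [IsScalarTower.algebraMap_apply (Polynomial K) K⟦X⟧ L, algebraMap_polynomial_powerSeries,
      Polynomial.coe_X] at hX

theorem IsCatalyticSolution.isAlgebraic_of_evalOrigin_ne_zero_of_field
    (hF : IsCatalyticSolution F₀ Q F)
    (hQ : evalOrigin F₀ (MvPolynomial.pderiv (.inl (Fin.last k)) Q) ≠ 0) :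
    IsAlgebraic (Polynomial (Polynomial K)) F := by
  by_contra htr
  let L := FractionRing (Polynomial K)⟦X⟧
  have : CharZero L := charZero_of_injective_algebraMap (FaithfulSMul.algebraMap_injective K L)
  obtain ⟨D, hD⟩ := exists_derivation_ne_zero
    ((transcendental_algebraMap_iff (IsFractionRing.injective (Polynomial K)⟦X⟧ L)).2 htr)
  let δ : Derivation (Polynomial (Polynomial K)) (Polynomial K)⟦X⟧ L := D.compAlgebraMap _
  have hδ : ∀ p : Polynomial (Polynomial K), δ (p : (Polynomial K)⟦X⟧) = 0 := fun p => by
    rw [← algebraMap_polynomial_powerSeries, Derivation.map_algebraMap]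
  have hcoeff : ∀ j : Fin k, δ (PowerSeries.map Polynomial.C (uCoeff j F)) = 0 := fun j =>
    derivation_eq_zero_of_isAlgebraic δ
      (isAlgebraic_map Polynomial.C (hF.isAlgebraic_uCoeff_of_evalOrigin_ne_zero hQ j))
  have h := hF.isCatalyticSequence.kernel_smul_derivation (fun _ => rfl) (δ.restrictScalars K)
    (by simpa using hδ Polynomial.X) (by simpa using hδ (Polynomial.C Polynomial.X))
  simp only [Derivation.restrictScalars_apply, hcoeff, smul_zero, Finset.sum_const_zero,
    neg_zero] at h
  refine (smul_eq_zero.1 h).elim (fun hkernel => ?_) hD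
  simpa using congrArg constantCoeff hkernel

end NondegenerateEquation

section AlgebraicSolutions

universe u

variable {k : ℕ}

-- `R = ℤ[X_a : a ∈ K][ε]`, specialized at `X_a = a` and `ε = 0`; the term `ε y_k` added to `Q`
-- makes the lifted equation nondegenerate.
theorem exists_charZero_lift_evalOrigin_ne_zero {K : Type u} [CommRing K] (F₀ : Polynomial K)
    (Q : MvPolynomial (Fin (k + 1) ⊕ Fin 2) K) :
    ∃ (R : Type u) (_ : CommRing R) (_ : IsDomain R) (_ : CharZero R) (e : R →+* K)
      (F₀' : Polynomial R) (Q' : MvPolynomial (Fin (k + 1) ⊕ Fin 2) R),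
      F₀'.map e = F₀ ∧ MvPolynomial.map e Q' = Q ∧
        evalOrigin F₀' (MvPolynomial.pderiv (.inl (Fin.last k)) Q') ≠ 0 := by
  let π : MvPolynomial K ℤ →+* K := MvPolynomial.eval₂Hom (Int.castRingHom K) id
  have hπ : Function.Surjective π := fun a => ⟨.X a, MvPolynomial.eval₂Hom_X' _ _ a⟩
  let e : Polynomial (MvPolynomial K ℤ) →+* K := π.comp Polynomial.constantCoeff
  have heC : e.comp Polynomial.C = π := RingHom.ext fun a => by simp [e]
  obtain ⟨G₀, rfl⟩ := Polynomial.map_surjective π hπ F₀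
  obtain ⟨P, rfl⟩ := MvPolynomial.map_surjective π hπ Q
  let Q' := MvPolynomial.map Polynomial.C P +
    MvPolynomial.C Polynomial.X * MvPolynomial.X (Sum.inl (Fin.last k))
  refine ⟨_, inferInstance, inferInstance, inferInstance, e, G₀.map Polynomial.C, Q', ?_, ?_, ?_⟩
  · rw [Polynomial.map_map, heC]
  · simp [Q', MvPolynomial.map_map, heC, e]
  · have hQ' : evalOrigin (G₀.map Polynomial.C) (MvPolynomial.pderiv (.inl (Fin.last k)) Q') =
        Polynomial.X +
          Polynomial.C (evalOrigin G₀ (MvPolynomial.pderiv (.inl (Fin.last k)) P)) := by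
      rw [← evalOrigin_map]
      simp [Q', evalOrigin, MvPolynomial.pderiv_map, add_comm]
    rw [hQ']
    exact Polynomial.X_add_C_ne_zero _

theorem IsCatalyticSolution.isAlgebraic_of_evalOrigin_ne_zero {R : Type*} [CommRing R]
    [IsDomain R] [CharZero R] {F₀ : Polynomial R} {Q : MvPolynomial (Fin (k + 1) ⊕ Fin 2) R}
    {F : (Polynomial R)⟦X⟧} (hF : IsCatalyticSolution F₀ Q F)
    (hQ : evalOrigin F₀ (MvPolynomial.pderiv (.inl (Fin.last k)) Q) ≠ 0) :
    IsAlgebraic (Polynomial (Polynomial R)) F := by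
  let φ := algebraMap R (FractionRing R)
  have hφ : Function.Injective φ := IsFractionRing.injective R (FractionRing R)
  refine (isAlgebraic_map_iff (φ := Polynomial.mapRingHom φ) (Polynomial.map_injective φ hφ)).1
    ((hF.map φ).isAlgebraic_of_evalOrigin_ne_zero_of_field ?_)
  rwa [MvPolynomial.pderiv_map, evalOrigin_map, Ne, map_eq_zero_iff φ hφ]

variable {K : Type*} [Field K]

theorem IsCatalyticSolution.isAlgebraic {F₀ : Polynomial K}
    {Q : MvPolynomial (Fin (k + 1) ⊕ Fin 2) K} {F : (Polynomial K)⟦X⟧}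
    (hF : IsCatalyticSolution F₀ Q F) : IsAlgebraic (Polynomial (Polynomial K)) F := by
  obtain ⟨R, _, _, _, e, F₀', Q', hF₀, hQ, hnondeg⟩ := exists_charZero_lift_evalOrigin_ne_zero F₀ Q
  obtain ⟨F', hF', -⟩ := existsUnique_isCatalyticSolution F₀' Q'
  have hmap := hF'.map e
  rw [hF₀, hQ] at hmap
  rw [(existsUnique_isCatalyticSolution F₀ Q).unique hF hmap]
  exact isAlgebraic_map _ (hF'.isAlgebraic_of_evalOrigin_ne_zero hnondeg)

variable {F : (Polynomial K)⟦X⟧}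

theorem isAlgebraic_uCoeff_zero (hF : IsAlgebraic (Polynomial (Polynomial K)) F) :
    IsAlgebraic (Polynomial K) (uCoeff 0 F) := by
  have h : uCoeff 0 F = map (Polynomial.evalRingHom 0) F := by
    ext n
    simp [uCoeff, Polynomial.coeff_zero_eq_eval_zero]
  rw [h]
  exact isAlgebraic_map _ hF

theorem isAlgebraic_dividedDifference (hF : IsAlgebraic (Polynomial (Polynomial K)) F) :
    IsAlgebraic (Polynomial (Polynomial K)) (dividedDifference F) := by
  have hu₀ : (C Polynomial.X : (Polynomial K)⟦X⟧) ≠ 0 :=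
    (map_ne_zero_iff _ C_injective).2 Polynomial.X_ne_zero
  have hu : IsAlgebraic (Polynomial (Polynomial K)) (C Polynomial.X : (Polynomial K)⟦X⟧) := by
    rw [← Polynomial.coe_C, ← algebraMap_polynomial_powerSeries]
    exact isAlgebraic_algebraMap _
  refine .of_mul (mem_nonZeroDivisors_of_ne_zero hu₀) hu ?_
  have hΔ := C_X_mul_iterate_dividedDifference_succ F 0
  rw [zero_add, Function.iterate_one, Function.iterate_zero_apply] at hΔ
  rw [hΔ]
  exact hF.sub (isAlgebraic_map Polynomial.C (isAlgebraic_uCoeff_zero hF))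

theorem isAlgebraic_uCoeff (hF : IsAlgebraic (Polynomial (Polynomial K)) F) (i : ℕ) :
    IsAlgebraic (Polynomial K) (uCoeff i F) := by
  rw [← uCoeff_zero_iterate_dividedDifference]
  exact isAlgebraic_uCoeff_zero
    (Function.Iterate.rec (IsAlgebraic (Polynomial (Polynomial K)))
      hF (fun _ => isAlgebraic_dividedDifference) i)

end AlgebraicSolutions

section AlgebraicOver

variable {K S Z : Type*} [Field K] [CommRing S] [CommRing Z] [IsDomain Z] [Algebra K S]
  [Algebra K Z] [Algebra S Z] [IsScalarTower K S Z] [FaithfulSMul S Z]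

open scoped IntermediateField.algebraAdjoinAdjoin in
theorem isAlgebraicOver_image_algebraMap_iff {s : Set S} (hs : Algebra.adjoin K s = ⊤) (a : Z) :
    IsAlgebraicOver K (algebraMap S Z '' s) a ↔ IsAlgebraic S a := by
  let N := FractionRing Z
  let f : S →ₐ[K] N := (IsScalarTower.toAlgHom K Z N).comp (IsScalarTower.toAlgHom K S Z)
  have hf : Function.Injective f :=
    (IsFractionRing.injective Z N).comp (FaithfulSMul.algebraMap_injective S Z)
  have hrange : f.range = Algebra.adjoin K (algebraMap Z N '' (algebraMap S Z '' s)) := by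
    rw [← Algebra.map_top, ← hs, AlgHom.map_adjoin, Set.image_image]
    rfl
  let e := (AlgEquiv.ofInjective f hf).trans (Subalgebra.equivOfEq _ _ hrange)
  rw [IsAlgebraicOver, ← IsFractionRing.isAlgebraic_iff
    (Algebra.adjoin K (algebraMap Z N '' (algebraMap S Z '' s)))]
  exact isAlgebraic_ringHom_iff_of_comp_eq e (algebraMap Z N) (IsFractionRing.injective Z N) rfl

theorem adjoin_X_C_X (R : Type*) [CommRing R] :
    Algebra.adjoin R {Polynomial.X, Polynomial.C (Polynomial.X : Polynomial R)} = ⊤ := by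
  have hC : Algebra.adjoin R {Polynomial.C (Polynomial.X : Polynomial R)} =
      (IsScalarTower.toAlgHom R (Polynomial R) (Polynomial (Polynomial R))).range := by
    rw [← Algebra.map_top, ← Polynomial.adjoin_X, AlgHom.map_adjoin, Set.image_singleton]
    rfl
  rw [Set.pair_comm, Set.insert_eq, Algebra.adjoin_union, hC,
    ← Algebra.Subalgebra.restrictScalars_adjoin, Polynomial.adjoin_X,
    Subalgebra.restrictScalars_top]

theorem isAlgebraicOver_X_iff {a : K⟦X⟧} :
    IsAlgebraicOver K {(X : K⟦X⟧)} a ↔ IsAlgebraic (Polynomial K) a := by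
  rw [← isAlgebraicOver_image_algebraMap_iff Polynomial.adjoin_X, Set.image_singleton,
    algebraMap_polynomial_powerSeries, Polynomial.coe_X]

theorem isAlgebraicOver_tVar_uVar_iff {F : (Polynomial K)⟦X⟧} :
    IsAlgebraicOver K {tVar K, uVar K} F ↔ IsAlgebraic (Polynomial (Polynomial K)) F := by
  rw [← isAlgebraicOver_image_algebraMap_iff (adjoin_X_C_X K), Set.image_pair,
    algebraMap_polynomial_powerSeries, algebraMap_polynomial_powerSeries, Polynomial.coe_X,
    Polynomial.coe_C]
  rfl

end AlgebraicOver

end Catalytic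

theorem mainTheorem1_general {K : Type*} [Field K] (k : ℕ) (F₀ : Polynomial K)
    (Q : MvPolynomial (Fin (k + 1) ⊕ Fin 2) K) :
    (∃! F : PowerSeries (Polynomial K), Catalytic.IsSolution F₀ Q F) ∧
    ∀ F : PowerSeries (Polynomial K), Catalytic.IsSolution F₀ Q F →
      Catalytic.IsAlgebraicOver K {Catalytic.tVar K, Catalytic.uVar K} F ∧
      ∀ i : ℕ, Catalytic.IsAlgebraicOver K {(PowerSeries.X : PowerSeries K)}
        (Catalytic.uCoeff i F) := by
  refine ⟨Catalytic.existsUnique_isCatalyticSolution F₀ Q, fun F hF => ?_⟩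
  have halg : IsAlgebraic (Polynomial (Polynomial K)) F :=
    Catalytic.IsCatalyticSolution.isAlgebraic hF
  exact ⟨Catalytic.isAlgebraicOver_tVar_uVar_iff.2 halg,
    fun i => Catalytic.isAlgebraicOver_X_iff.2 (Catalytic.isAlgebraic_uCoeff halg i)⟩

theorem mainTheorem1 {K : Type*} [Field K] [CharZero K] (k : ℕ) (F₀ : Polynomial K)
    (Q : MvPolynomial (Fin (k + 1) ⊕ Fin 2) K) :
    (∃! F : PowerSeries (Polynomial K), Catalytic.IsSolution F₀ Q F) ∧
    ∀ F : PowerSeries (Polynomial K), Catalytic.IsSolution F₀ Q F →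
      Catalytic.IsAlgebraicOver K {Catalytic.tVar K, Catalytic.uVar K} F ∧
      ∀ i : ℕ, Catalytic.IsAlgebraicOver K {(PowerSeries.X : PowerSeries K)}
        (Catalytic.uCoeff i F) :=
  mainTheorem1_general k F₀ Q
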